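/- Let $\alpha,\beta>0$. On $(0,1)$ consider the hinged thermoelastic-type beam with complex-valued unknowns $u,\theta$ $$\begin{cases} u_{tt}+u_{xxxx}+\alpha\,\theta_{xx}=0, & t\ge 0,\ 0<x<1,\\ \theta_t+\beta\,\theta-\alpha\,u_{txx}=0, & t\ge 0,\ 0<x<1,\\ u(0,t)=u(1,t)=u_{xx}(0,t)=u_{xx}(1,t)=0, & t\ge 0,\\ u(\cdot,0)=u_0,\quad u_t(\cdot,0)=u_1,\quad \theta(\cdot,0)=\theta_0. \end{cases}$$ Let $V=H^2(0,1)\cap H^1_0(0,1)$ with norm $\|u_{xx}\|_{L^2(0,1)}$, and let $\mathcal H=V\times L^2(0,1)\times L^2(0,1)$. The system is understood as the Cauchy problem $z'=\mathcal A z$, $z(0)=U_0=(u_0,u_1,\theta_0)$ in $\mathcal H$ for $z=(u,u_t,\theta)$, where $$\mathcal A(u,v,\theta)=\bigl(v,\,-(u_{xxxx}+\alpha\theta_{xx}),\,\alpha v_{xx}-\beta\theta\bigr),\qquad \mathcal D(\mathcal A)=\{(u,v,\theta)\in V\times V\times L^2(0,1):\ u_{xxxx}+\alpha\theta_{xx}\in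 L^2(0,1)\},$$ and $u_{xxxx}+\alpha\theta_{xx}$ denotes the functional $\varphi\mapsto\int_0^1 (u_{xx}+\alpha\theta)\,\overline{\varphi_{xx}}\,dx$ on $V$. A (mild) solution is a function $z\in C([0,\infty),\mathcal H)$ with $z(0)=U_0$ such that, for all $t\ge 0$, $\int_0^t z(s)\,ds\in\mathcal D(\mathcal A)$ and $z(t)=U_0+\mathcal A\int_0^t z(s)\,ds$. Then for every $U_0\in\mathcal H$ there is a unique solution, and its energy $$E(t)=\tfrac12\Bigl(\int_0^1|u_{xx}(x,t)|^2\,dx+\int_0^1|u_t(x,t)|^2\,dx+\int_0^1|\theta(x,t)|^2\,dx\Bigr)$$ decays exponentially, uniformly in the initial data: there are constants $C>0$ and $\omega>0$, depending only on $\alpha$ and $\beta$, such that for every $U_0\in\mathcal H$ $$E(t)\le C\,e^{-\omega t}\,E(0)\qquad\text{for all } t\ge 0 .$$ -/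

import Mathlib

open MeasureTheory Set Topology
open scoped ContDiff ENNReal

namespace HingedBeam

noncomputable section

/-! ### Sobolev spaces on the interval `(0,1)` -/

/-- Lebesgue measure on `(0,1)`. -/
abbrev leb : Measure ℝ := volume.restrict (Ioo (0 : ℝ) 1)

/-- The complex Hilbert space `L²(0,1)`. -/
abbrev L2 : Type := Lp ℂ 2 leb

/-- Test functions: smooth complex functions with compact support contained in `(0,1)`. -/
structure IsTest (φ : ℝ → ℂ) : Prop where
  smooth : ContDiff ℝ ∞ φ
  compact : HasCompactSupport φ
  support : tsupport φ ⊆ Ioo 0 1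

/-- `g` is the weak (distributional) derivative of `f` on `(0,1)`. -/
def HasWeakDeriv (f g : L2) : Prop :=
  ∀ φ : ℝ → ℂ, IsTest φ →
    ∫ x in Ioo (0 : ℝ) 1, f x * deriv φ x = -∫ x in Ioo (0 : ℝ) 1, g x * φ x

theorem IsTest.deriv {φ : ℝ → ℂ} (h : IsTest φ) : IsTest (deriv φ) where
  smooth := (contDiff_infty_iff_deriv.1 h.smooth).2
  compact := h.compact.deriv
  support := (closure_minimal (support_deriv_subset) (isClosed_tsupport φ)).trans h.support

theorem IsTest.differentiable {φ : ℝ → ℂ} (h : IsTest φ) : Differentiable ℝ φ :=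
  h.smooth.differentiable (by simp)

theorem IsTest.zero : IsTest (0 : ℝ → ℂ) where
  smooth := contDiff_const
  compact := HasCompactSupport.zero
  support := by simp [tsupport]

theorem IsTest.add {φ ψ : ℝ → ℂ} (h : IsTest φ) (h' : IsTest ψ) : IsTest (φ + ψ) where
  smooth := h.smooth.add h'.smooth
  compact := h.compact.add h'.compact
  support := (tsupport_add φ ψ).trans (union_subset h.support h'.support)

theorem IsTest.smul {φ : ℝ → ℂ} (c : ℂ) (h : IsTest φ) : IsTest (c • φ) where
  smooth := h.smooth.const_smul c
  compact := h.compact.smul_left (f := fun _ => c)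
  support := (closure_mono (Function.support_const_smul_subset c φ)).trans h.support

theorem IsTest.conj {φ : ℝ → ℂ} (h : IsTest φ) :
    IsTest (fun x => (starRingEnd ℂ) (φ x)) where
  smooth := Complex.conjCLE.contDiff.comp h.smooth
  compact := h.compact.comp_left (g := starRingEnd ℂ) (map_zero _)
  support := by
    refine (closure_mono ?_).trans h.support
    exact Function.support_comp_subset (map_zero (starRingEnd ℂ)) φ

theorem deriv_conj {φ : ℝ → ℂ} (h : IsTest φ) (x : ℝ) :
    deriv (fun y => (starRingEnd ℂ) (φ y)) x = (starRingEnd ℂ) (deriv φ x) :=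
  ((Complex.conjCLE : ℂ →L[ℝ] ℂ).hasFDerivAt.comp_hasDerivAt x
    (h.differentiable x).hasDerivAt).deriv

theorem IsTest.memLp {φ : ℝ → ℂ} (h : IsTest φ) : MemLp φ 2 leb :=
  (h.smooth.continuous.memLp_of_hasCompactSupport (μ := volume) h.compact).restrict _

theorem integral_mul_conj_eq_inner {g : L2} {φ : ℝ → ℂ} (f : L2) (hg : g =ᵐ[leb] φ) :
    ∫ x in Ioo (0 : ℝ) 1, f x * (starRingEnd ℂ) (φ x) = inner ℂ g f := by
  rw [L2.inner_def]
  refine integral_congr_ae ?_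
  filter_upwards [hg] with x hx
  rw [RCLike.inner_apply, hx]

/-- Weak differentiability expressed by inner products in `L²(0,1)`. -/
theorem HasWeakDeriv.inner_eq {f g w w' : L2} (h : HasWeakDeriv f g) {φ : ℝ → ℂ}
    (hφ : IsTest φ) (hw : w =ᵐ[leb] φ) (hw' : w' =ᵐ[leb] _root_.deriv φ) :
    inner ℂ w' f = -inner ℂ w g := by
  rw [← integral_mul_conj_eq_inner f hw', ← integral_mul_conj_eq_inner g hw, ← h _ hφ.conj]
  simp_rw [deriv_conj hφ]

theorem hasWeakDeriv_iff {f g : L2} :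
    HasWeakDeriv f g ↔ ∀ (φ : ℝ → ℂ) (w w' : L2), IsTest φ → w =ᵐ[leb] φ →
      w' =ᵐ[leb] _root_.deriv φ → inner ℂ w' f = -inner ℂ w g := by
  refine ⟨fun h φ w w' hφ hw hw' => h.inner_eq hφ hw hw', fun h φ hφ => ?_⟩
  have h1 := h _ (hφ.conj.memLp.toLp _) (hφ.conj.deriv.memLp.toLp _) hφ.conj
    (MemLp.coeFn_toLp _) (MemLp.coeFn_toLp _)
  rw [← integral_mul_conj_eq_inner f (MemLp.coeFn_toLp _),
    ← integral_mul_conj_eq_inner g (MemLp.coeFn_toLp _)] at h1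
  simpa [deriv_conj hφ] using h1

theorem isClosed_hasWeakDeriv : IsClosed {p : L2 × L2 | HasWeakDeriv p.1 p.2} := by
  simp only [hasWeakDeriv_iff, ofPred_forall]
  refine isClosed_iInter fun φ => isClosed_iInter fun w => isClosed_iInter fun w' =>
    isClosed_iInter fun _ => isClosed_iInter fun _ => isClosed_iInter fun _ => ?_
  exact isClosed_eq (by fun_prop) (by fun_prop)

theorem HasWeakDeriv.zero : HasWeakDeriv 0 0 := by
  rw [hasWeakDeriv_iff]; intros; simp

theorem HasWeakDeriv.add {f g f' g' : L2} (h : HasWeakDeriv f g) (h' : HasWeakDeriv f' g') :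
    HasWeakDeriv (f + f') (g + g') := by
  rw [hasWeakDeriv_iff]
  intro φ w w' hφ hw hw'
  rw [inner_add_right, inner_add_right, h.inner_eq hφ hw hw', h'.inner_eq hφ hw hw']
  ring

theorem HasWeakDeriv.smul {f g : L2} (c : ℂ) (h : HasWeakDeriv f g) :
    HasWeakDeriv (c • f) (c • g) := by
  rw [hasWeakDeriv_iff]
  intro φ w w' hφ hw hw'
  rw [inner_smul_right, inner_smul_right, h.inner_eq hφ hw hw']
  ring

/-- The weak derivative is unique. -/
theorem HasWeakDeriv.unique {f g g' : L2} (h : HasWeakDeriv f g) (h' : HasWeakDeriv f g') :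
    g = g' := by
  have hd : HasWeakDeriv 0 (g - g') := by
    have := h.add (h'.smul (-1)); simpa [sub_eq_add_neg] using this
  rw [← sub_eq_zero]
  have hint : LocallyIntegrableOn (g - g' : L2) (Ioo (0 : ℝ) 1) volume :=
    (show IntegrableOn (g - g' : L2) (Ioo (0 : ℝ) 1) volume from
      (Lp.memLp (g - g')).integrable (by norm_num)).locallyIntegrableOn
  have key := isOpen_Ioo.ae_eq_zero_of_integral_contDiff_smul_eq_zero hint (fun k hk hc hs => by
    have ht : IsTest (fun x => (k x : ℂ)) :=
      { smooth := Complex.ofRealCLM.contDiff.comp hk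
        compact := hc.comp_left (g := Complex.ofReal) Complex.ofReal_zero
        support := (closure_mono
          (Function.support_comp_subset Complex.ofReal_zero k)).trans hs }
    have h1 := hd _ ht
    have h2 : ∫ x in Ioo (0 : ℝ) 1, (0 : L2) x * _root_.deriv (fun x => (k x : ℂ)) x = 0 := by
      rw [integral_congr_ae (g := fun _ => (0 : ℂ))]
      · simp
      · filter_upwards [Lp.coeFn_zero ℂ 2 leb] with x hx
        rw [hx, Pi.zero_apply, zero_mul]
    rw [h2, eq_comm, neg_eq_zero] at h1
    rw [← setIntegral_eq_integral_of_forall_compl_eq_zero (s := Ioo (0 : ℝ) 1), ← h1]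
    · refine integral_congr_ae (Filter.Eventually.of_forall fun x => ?_)
      simp [mul_comm]
    · intro x hx
      have : k x = 0 := image_eq_zero_of_notMem_tsupport fun hx' => hx (hs hx')
      simp [this])
  refine Lp.eq_zero_iff_ae_eq_zero.2 ?_
  rw [Filter.EventuallyEq, ae_restrict_iff' measurableSet_Ioo]
  exact key

/-- The pairs `(φ, φ')`, `φ` a test function, as a subspace of `L²(0,1) × L²(0,1)`. -/
def testGraph : Submodule ℂ (L2 × L2) where
  carrier := {p | ∃ φ : ℝ → ℂ, IsTest φ ∧ p.1 =ᵐ[leb] φ ∧ p.2 =ᵐ[leb] deriv φ}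
  zero_mem' := ⟨0, IsTest.zero, Lp.coeFn_zero ℂ 2 leb, by
    have : deriv (0 : ℝ → ℂ) = 0 := by ext x; simp
    rw [this]; exact Lp.coeFn_zero ℂ 2 leb⟩
  add_mem' := by
    rintro p q ⟨φ, hφ, h1, h2⟩ ⟨ψ, hψ, h3, h4⟩
    refine ⟨φ + ψ, hφ.add hψ, (Lp.coeFn_add _ _).trans (h1.add h3), ?_⟩
    have : deriv (φ + ψ) = deriv φ + deriv ψ := by
      ext x; exact deriv_add (hφ.differentiable x) (hψ.differentiable x)
    rw [this]
    exact (Lp.coeFn_add _ _).trans (h2.add h4)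
  smul_mem' := by
    rintro c p ⟨φ, hφ, h1, h2⟩
    refine ⟨c • φ, hφ.smul c, (Lp.coeFn_smul _ _).trans (h1.const_smul c), ?_⟩
    have : deriv (c • φ) = c • deriv φ := by
      ext x; exact deriv_const_smul c (hφ.differentiable x)
    rw [this]
    exact (Lp.coeFn_smul _ _).trans (h2.const_smul c)

/-- The pairs `(u, u')` with `u ∈ H¹₀(0,1)`, `H¹₀` being the closure of the test functions in `H¹`. -/
def H10Graph : Submodule ℂ (L2 × L2) := testGraph.topologicalClosure

/-- `H¹₀(0,1)`. -/
def H10 : Submodule ℂ L2 := H10Graph.map (LinearMap.fst ℂ L2 L2)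

/-- `H²(0,1)`: the functions with two weak derivatives in `L²(0,1)`. -/
def H2 : Submodule ℂ L2 where
  carrier := {u | ∃ p q : L2, HasWeakDeriv u p ∧ HasWeakDeriv p q}
  zero_mem' := ⟨0, 0, HasWeakDeriv.zero, HasWeakDeriv.zero⟩
  add_mem' := by
    rintro u v ⟨p, q, h1, h2⟩ ⟨p', q', h3, h4⟩
    exact ⟨p + p', q + q', h1.add h3, h2.add h4⟩
  smul_mem' := by
    rintro c u ⟨p, q, h1, h2⟩
    exact ⟨c • p, c • q, h1.smul c, h2.smul c⟩

theorem hasWeakDeriv_of_mem_H10Graph {p : L2 × L2} (hp : p ∈ H10Graph) :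
    HasWeakDeriv p.1 p.2 := by
  refine closure_minimal ?_ isClosed_hasWeakDeriv hp
  rintro ⟨u, v⟩ ⟨φ, hφ, h1, h2⟩ ψ hψ
  simp only at h1 h2
  have e1 : ∫ x in Ioo (0 : ℝ) 1, u x * deriv ψ x = ∫ x, φ x * deriv ψ x := by
    rw [← setIntegral_eq_integral_of_forall_compl_eq_zero (s := Ioo (0 : ℝ) 1)
      (f := fun x => φ x * deriv ψ x)]
    · refine integral_congr_ae ?_
      filter_upwards [h1] with x hx
      rw [hx]
    · intro x hx
      have : φ x = 0 := image_eq_zero_of_notMem_tsupport fun hx' => hx (hφ.support hx')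
      simp [this]
  have e2 : ∫ x in Ioo (0 : ℝ) 1, v x * ψ x = ∫ x, deriv φ x * ψ x := by
    rw [← setIntegral_eq_integral_of_forall_compl_eq_zero (s := Ioo (0 : ℝ) 1)
      (f := fun x => deriv φ x * ψ x)]
    · refine integral_congr_ae ?_
      filter_upwards [h2] with x hx
      rw [hx]
    · intro x hx
      have : ψ x = 0 := image_eq_zero_of_notMem_tsupport fun hx' => hx (hψ.support hx')
      simp [this]
  rw [e1, e2]
  refine integral_mul_deriv_eq_deriv_mul_of_integrable
    (fun x _ => (hφ.differentiable x).hasDerivAt) (fun x _ => (hψ.differentiable x).hasDerivAt) ?_ ?_ ?_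
  · exact (hφ.smooth.continuous.mul hψ.deriv.smooth.continuous).integrable_of_hasCompactSupport
      hφ.compact.mul_right
  · exact (hφ.deriv.smooth.continuous.mul hψ.smooth.continuous).integrable_of_hasCompactSupport
      hφ.deriv.compact.mul_right
  · exact (hφ.smooth.continuous.mul hψ.smooth.continuous).integrable_of_hasCompactSupport
      hφ.compact.mul_right

/-- Poincaré's inequality on `H¹₀(0,1)`. -/
theorem norm_le_of_mem_H10Graph {p : L2 × L2} (hp : p ∈ H10Graph) : ‖p.1‖ ≤ ‖p.2‖ := by
  have hcl : IsClosed {p : L2 × L2 | ‖p.1‖ ≤ ‖p.2‖} := isClosed_le (by fun_prop) (by fun_prop)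
  refine closure_minimal ?_ hcl hp
  rintro ⟨u, v⟩ ⟨φ, hφ, h1, h2⟩
  simp only at h1 h2
  simp only [mem_ofPred_eq]
  have : IsProbabilityMeasure leb := ⟨by simp⟩
  have hv : ∫ x in Ioo (0 : ℝ) 1, ‖deriv φ x‖ ≤ ‖v‖ := by
    have hi : eLpNorm (deriv φ) 1 leb ≤ eLpNorm v 2 leb := by
      rw [eLpNorm_congr_ae h2]
      exact eLpNorm_le_eLpNorm_of_exponent_le (by norm_num) hφ.deriv.memLp.aestronglyMeasurable
    rw [Lp.norm_def, integral_norm_eq_lintegral_enorm hφ.deriv.memLp.aestronglyMeasurable,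
      ← eLpNorm_one_eq_lintegral_enorm]
    exact ENNReal.toReal_mono (Lp.eLpNorm_ne_top v) hi
  have hb : ∀ᵐ x ∂leb, ‖u x‖ ≤ ‖v‖ := by
    filter_upwards [h1, ae_restrict_mem measurableSet_Ioo] with x hx hmem
    rw [hx]
    have h0 : φ 0 = 0 := image_eq_zero_of_notMem_tsupport fun hx' => by
      have := hφ.support hx'; simp at this
    have hftc : ∫ y in (0 : ℝ)..x, deriv φ y = φ x := by
      rw [intervalIntegral.integral_deriv_eq_sub (fun y _ => hφ.differentiable y)
        (hφ.deriv.smooth.continuous.intervalIntegrable _ _), h0, sub_zero]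
    rw [← hftc]
    refine (intervalIntegral.norm_integral_le_integral_norm hmem.1.le).trans
      (le_trans ?_ hv)
    rw [intervalIntegral.integral_of_le hmem.1.le]
    refine setIntegral_mono_set ?_ (Filter.Eventually.of_forall fun _ => norm_nonneg _) ?_
    · exact (hφ.deriv.memLp.integrable (by norm_num)).norm
    · exact (LE.le.eventuallyLE fun y hy => ⟨hy.1, hy.2.trans_lt hmem.2⟩)
  have hm : measureUnivNNReal leb = 1 := by simp [measureUnivNNReal]
  simpa [hm] using Lp.norm_le_of_ae_bound (norm_nonneg v) hb

/-! ### The form domain `V = H²(0,1) ∩ H¹₀(0,1)` -/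

/-- The vector space `H²(0,1) ∩ H¹₀(0,1)`. Its norm, defined below, is `‖u''‖` in `L²(0,1)`. -/
def V : Type := ↥(H2 ⊓ H10)

instance : AddCommGroup V := inferInstanceAs (AddCommGroup ↥(H2 ⊓ H10))

instance : Module ℂ V := inferInstanceAs (Module ℂ ↥(H2 ⊓ H10))

/-- The inclusion of `V` into `L²(0,1)`. -/
def V.incl : V →ₗ[ℂ] L2 := (H2 ⊓ H10).subtype

theorem V.incl_injective : Function.Injective V.incl := Subtype.val_injective

theorem V.exists_derivs (u : V) :
    ∃ p q : L2, (V.incl u, p) ∈ H10Graph ∧ HasWeakDeriv p q := by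
  obtain ⟨⟨p, q, h1, h2⟩, ⟨⟨_, p'⟩, h3, rfl⟩⟩ := u.2
  have h4 := hasWeakDeriv_of_mem_H10Graph h3
  obtain rfl : p = p' := h1.unique h4
  exact ⟨p, q, h3, h2⟩

theorem V.exists_of_derivs {f p q : L2} (h1 : (f, p) ∈ H10Graph) (h2 : HasWeakDeriv p q) :
    ∃ u : V, V.incl u = f :=
  ⟨⟨f, ⟨p, q, hasWeakDeriv_of_mem_H10Graph h1, h2⟩, ⟨(f, p), h1, rfl⟩⟩, rfl⟩

theorem V.exists_D2 (u : V) : ∃ q : L2, ∃ p : L2, HasWeakDeriv (V.incl u) p ∧ HasWeakDeriv p q := by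
  obtain ⟨p, q, h1, h2⟩ := V.exists_derivs u
  exact ⟨q, p, hasWeakDeriv_of_mem_H10Graph h1, h2⟩

/-- The second weak derivative `u ↦ u''` on `V`. -/
def V.D2 : V →ₗ[ℂ] L2 where
  toFun u := Classical.choose (V.exists_D2 u)
  map_add' u v := by
    obtain ⟨p, h1, h2⟩ := Classical.choose_spec (V.exists_D2 u)
    obtain ⟨p', h3, h4⟩ := Classical.choose_spec (V.exists_D2 v)
    obtain ⟨p'', h5, h6⟩ := Classical.choose_spec (V.exists_D2 (u + v))
    rw [map_add] at h5
    obtain rfl := h5.unique (h1.add h3)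
    exact h6.unique (h2.add h4)
  map_smul' c u := by
    obtain ⟨p, h1, h2⟩ := Classical.choose_spec (V.exists_D2 u)
    obtain ⟨p'', h5, h6⟩ := Classical.choose_spec (V.exists_D2 (c • u))
    rw [map_smul] at h5
    obtain rfl := h5.unique (h1.smul c)
    exact h6.unique (h2.smul c)

theorem V.D2_spec (u : V) :
    ∃ p : L2, HasWeakDeriv (V.incl u) p ∧ HasWeakDeriv p (V.D2 u) :=
  Classical.choose_spec (V.exists_D2 u)

theorem V.exists_deriv (u : V) :
    ∃ p : L2, (V.incl u, p) ∈ H10Graph ∧ HasWeakDeriv p (V.D2 u) := by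
  obtain ⟨p, q, h1, h2⟩ := V.exists_derivs u
  obtain ⟨p', h3, h4⟩ := V.D2_spec u
  obtain rfl := h3.unique (hasWeakDeriv_of_mem_H10Graph h1)
  exact ⟨p', h1, h4⟩

theorem V.D2_eq {u : V} {p q : L2} (h1 : (V.incl u, p) ∈ H10Graph) (h2 : HasWeakDeriv p q) :
    V.D2 u = q := by
  obtain ⟨p', h3, h4⟩ := V.D2_spec u
  obtain rfl := h3.unique (hasWeakDeriv_of_mem_H10Graph h1)
  exact h4.unique h2

/-- Integration by parts against `H¹₀(0,1)`. -/
theorem HasWeakDeriv.inner_H10Graph {f g : L2} (h : HasWeakDeriv f g) {w : L2 × L2}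
    (hw : w ∈ H10Graph) : inner ℂ w.2 f = -inner ℂ w.1 g := by
  have hcl : IsClosed {w : L2 × L2 | inner ℂ w.2 f = -inner ℂ w.1 g} :=
    isClosed_eq (by fun_prop) (by fun_prop)
  refine closure_minimal ?_ hcl hw
  rintro ⟨u, v⟩ ⟨φ, hφ, h1, h2⟩
  exact h.inner_eq hφ h1 h2

theorem norm_le_of_derivs {u p q : L2} (h1 : (u, p) ∈ H10Graph) (h2 : HasWeakDeriv p q) :
    ‖u‖ ≤ ‖q‖ ∧ ‖p‖ ≤ ‖q‖ := by
  have hP := norm_le_of_mem_H10Graph h1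
  simp only at hP
  have hI := h2.inner_H10Graph h1
  simp only at hI
  have h3 : ‖p‖ ^ 2 ≤ ‖u‖ * ‖q‖ := by
    calc ‖p‖ ^ 2 = ‖inner ℂ p p‖ := by
          rw [inner_self_eq_norm_sq_to_K]; simp
      _ = ‖inner ℂ u q‖ := by rw [hI, norm_neg]
      _ ≤ ‖u‖ * ‖q‖ := norm_inner_le_norm u q
  have h4 : ‖p‖ ≤ ‖q‖ := by
    by_contra! h
    have : ‖u‖ * ‖q‖ ≤ ‖p‖ * ‖q‖ := by gcongr
    nlinarith [norm_nonneg q]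
  exact ⟨hP.trans h4, h4⟩

theorem V.D2_injective : Function.Injective V.D2 := by
  refine (injective_iff_map_eq_zero V.D2).2 fun u hu => ?_
  obtain ⟨p, h1, h2⟩ := V.exists_deriv u
  have h := (norm_le_of_derivs h1 h2).1
  rw [hu, norm_zero] at h
  exact V.incl_injective (by rw [map_zero]; exact norm_le_zero_iff.1 h)

/-- The norm of `V` is `‖u''‖` in `L²(0,1)`. -/
instance : NormedAddCommGroup V := NormedAddCommGroup.induced V L2 V.D2 V.D2_injective

/-- The inner product of `V` is `∫ u'' v''` (with a complex conjugate on one factor). -/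
instance : InnerProductSpace ℂ V := InnerProductSpace.induced V.D2

theorem V.norm_eq (u : V) : ‖u‖ = ‖V.D2 u‖ := rfl

theorem V.inner_eq (u v : V) : inner ℂ u v = inner ℂ (V.D2 u) (V.D2 v) := rfl

instance : CompleteSpace V := by
  refine Metric.complete_of_cauchySeq_tendsto fun u hu => ?_
  choose p h1 h2 using fun n => V.exists_deriv (u n)
  have hest : ∀ m n, ‖V.incl (u m) - V.incl (u n)‖ ≤ ‖u m - u n‖ ∧
      ‖p m - p n‖ ≤ ‖u m - u n‖ := by
    intro m n
    rw [V.norm_eq, map_sub]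
    refine norm_le_of_derivs (H10Graph.sub_mem (h1 m) (h1 n)) ?_
    have := (h2 m).add ((h2 n).smul (-1))
    simpa [sub_eq_add_neg] using this
  have hc : ∀ g : ℕ → L2, (∀ m n, ‖g m - g n‖ ≤ ‖u m - u n‖) → CauchySeq g := by
    intro g hg
    rw [Metric.cauchySeq_iff] at hu ⊢
    intro ε hε
    obtain ⟨N, hN⟩ := hu ε hε
    refine ⟨N, fun m hm n hn => lt_of_le_of_lt ?_ (hN m hm n hn)⟩
    rw [dist_eq_norm, dist_eq_norm]
    exact hg m n
  obtain ⟨f, hf⟩ := cauchySeq_tendsto_of_complete (hc _ fun m n => (hest m n).1)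
  obtain ⟨r, hr⟩ := cauchySeq_tendsto_of_complete (hc _ fun m n => (hest m n).2)
  obtain ⟨q, hq⟩ := cauchySeq_tendsto_of_complete (hc (fun n => V.D2 (u n)) fun m n => by
    rw [V.norm_eq, map_sub])
  have hH : (f, r) ∈ H10Graph :=
    testGraph.isClosed_topologicalClosure.mem_of_tendsto (hf.prodMk_nhds hr)
      (Filter.Eventually.of_forall h1)
  have hW : HasWeakDeriv r q :=
    isClosed_hasWeakDeriv.mem_of_tendsto (hr.prodMk_nhds hq) (Filter.Eventually.of_forall h2)
  obtain ⟨w, rfl⟩ := V.exists_of_derivs hH hW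
  refine ⟨w, ?_⟩
  rw [tendsto_iff_norm_sub_tendsto_zero] at hq ⊢
  refine hq.congr fun n => ?_
  rw [V.norm_eq, map_sub, V.D2_eq hH hW]

/-! ### The damped system -/

/-- The energy space `V × L²(0,1) × L²(0,1)`, a complex Hilbert space. Its elements are the triples
`(u, v, θ)` with `‖(u, v, θ)‖² = ‖u''‖² + ‖v‖² + ‖θ‖²`. -/
abbrev H : Type := WithLp 2 (V × WithLp 2 (L2 × L2))

/-- The displacement `u`. -/
abbrev H.u (z : H) : V := z.fst

/-- The velocity `v = u_t`. -/
abbrev H.v (z : H) : L2 := z.snd.fst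

/-- The temperature `θ`. -/
abbrev H.θ (z : H) : L2 := z.snd.snd

/-- The energy `E = (‖u''‖² + ‖u_t‖² + ‖θ‖²) / 2`. -/
def energy (z : H) : ℝ :=
  (1 / 2) * ((∫ x in Ioo (0 : ℝ) 1, ‖V.D2 z.u x‖ ^ 2) + (∫ x in Ioo (0 : ℝ) 1, ‖z.v x‖ ^ 2)
    + ∫ x in Ioo (0 : ℝ) 1, ‖z.θ x‖ ^ 2)

/-- `IsGenerator α β z w` says that `z = (u, v, θ)` lies in the domain of the operator
`𝒜 (u, v, θ) = (v, -(u'''' + α θ''), α v'' - β θ)` and that `𝒜 z = w`. The domain consists of the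
`(u, v, θ) ∈ V × V × L²` such that `u'''' + α θ''`, which is the antilinear functional
`φ ↦ ∫ u'' φ'' + α ∫ θ φ''` on `V` (with conjugates on `φ`), is represented by an element
of `L²(0,1)`. -/
structure IsGenerator (α β : ℝ) (z w : H) : Prop where
  displacement : V.incl w.u = z.v
  velocity : ∀ φ : V, inner ℂ (V.D2 φ) (V.D2 z.u) + (α : ℂ) * inner ℂ (V.D2 φ) z.θ
    = -inner ℂ (V.incl φ) w.v
  temperature : w.θ = (α : ℂ) • V.D2 w.u - (β : ℂ) • z.θ

/-- Mild solutions on `[0, ∞)` of `z' = 𝒜 z`, `z(0) = z₀`: the functions `z ∈ C([0, ∞); H)` with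
`∫₀ᵗ z ∈ D(𝒜)` and `z(t) = z₀ + 𝒜 ∫₀ᵗ z` for all `t ≥ 0`. -/
structure IsMildSolution (α β : ℝ) (z₀ : H) (z : ℝ → H) : Prop where
  continuousOn : ContinuousOn z (Ici 0)
  initial : z 0 = z₀
  integrated : ∀ t : ℝ, 0 ≤ t → IsGenerator α β (∫ s in (0 : ℝ)..t, z s) (z t - z₀)

end

end HingedBeam

namespace HingedBeam

/-! ### Derivatives of quadratic forms along curves in a complex Hilbert space. -/

section Abstract

variable {E : Type*} [NormedAddCommGroup E] [InnerProductSpace ℂ E]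

/-! Write Δ for the Dirichlet second derivative, an isometry of `V` onto `L2`. The generator 𝒜 has a
bounded, injective inverse G = `genInv`, so the unbounded operator and its domain can be avoided: by
`isGenerator_iff`, a mild solution is a continuous z with G (z t - z₀) = ∫₀ᵗ z.

Existence. G is dissipative: Re ⟨G w, w⟩ = -β‖θ‖² with θ the temperature of G w (`re_inner_genInv`).
The bounded operators (G - ε)⁻¹ are commuting, dissipative approximations of 𝒜. Their exponentials
are contractions and converge locally uniformly on the dense range of G², hence everywhere, to a
mild solution (`exists_mild_of_dissipative`).

Decay. The energy is damped only through θ, so it is corrected by cross terms: N‖z‖² + Re ⟨u -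
cΔ⁻¹θ, v⟩. Differentiating ⟨u, v⟩ produces -‖u''‖² + ‖v‖², and differentiating ⟨Δ⁻¹θ, v⟩ produces
α‖v‖², since Δ⁻¹ undoes the derivatives in the coupling αΔv. With c = 2/α the total is -‖u''‖² -
‖v‖² plus terms that contain θ, which a large N absorbs (`re_inner_lyapunov_deriv`, `exists_decay`).
Since mild solutions need not be differentiable, `norm_sq_le_of_lyapunov` works with their integrals
over short windows. Uniqueness is the decay estimate for a difference of two solutions. -/

theorem hasDerivAt_clm_comp {F : Type*} [NormedAddCommGroup F] [NormedSpace ℂ F]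
    (P : E →L[ℂ] F) {f : ℝ → E} {f' : E} {t : ℝ} (hf : HasDerivAt f f' t) :
    HasDerivAt (fun s => P (f s)) (P f') t :=
  (P.restrictScalars ℝ).hasFDerivAt.comp_hasDerivAt t hf

/-- `P` need not be self-adjoint, so the two terms do not merge into one. -/
theorem hasDerivAt_re_inner_clm (P : E →L[ℂ] E) {f : ℝ → E} {f' : E} {t : ℝ}
    (hf : HasDerivAt f f' t) :
    HasDerivAt (fun s => (inner ℂ (P (f s)) (f s)).re)
      ((inner ℂ (P (f t)) f').re + (inner ℂ (P f') (f t)).re) t := by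
  have h := (hasDerivAt_clm_comp P hf).inner ℂ hf
  exact (Complex.reCLM.hasFDerivAt.comp_hasDerivAt t h).congr_deriv (by simp)

theorem re_inner_self_eq_norm_sq (x : E) : (inner ℂ x x).re = ‖x‖ ^ 2 :=
  inner_self_eq_norm_sq (𝕜 := ℂ) x

variable [CompleteSpace E]

/-! ### Semigroups of contractions with invertible generators -/

theorem hasDerivAt_exp_apply (M : E →L[ℂ] E) (x : E) (t : ℝ) :
    HasDerivAt (fun s : ℝ => NormedSpace.exp (s • M) x) (M (NormedSpace.exp (t • M) x)) t := by
  have h := hasDerivAt_exp_smul_const' (𝕂 := ℝ) M t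
  exact ((ContinuousLinearMap.apply ℂ E x).restrictScalars ℝ).hasFDerivAt.comp_hasDerivAt t h

/-- The squared norm along the flow has derivative 2 Re ⟨M y, y⟩ ≤ 0. -/
theorem norm_exp_apply_le {M : E →L[ℂ] E} (hM : ∀ x, (inner ℂ (M x) x).re ≤ 0) (x : E) {t : ℝ}
    (ht : 0 ≤ t) : ‖NormedSpace.exp (t • M) x‖ ≤ ‖x‖ := by
  have hd := fun s => hasDerivAt_re_inner_clm (.id ℂ E) (hasDerivAt_exp_apply M x s)
  have hanti : Antitone fun s : ℝ => (inner ℂ (ContinuousLinearMap.id ℂ E (NormedSpace.exp (s • M) x))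
      (NormedSpace.exp (s • M) x)).re := by
    refine antitone_of_hasDerivAt_nonpos hd fun s => ?_
    have h1 := hM (NormedSpace.exp (s • M) x)
    have h2 := inner_re_symm (𝕜 := ℂ) (NormedSpace.exp (s • M) x) (M (NormedSpace.exp (s • M) x))
    simp only [RCLike.re_to_complex] at h2
    simp only [ContinuousLinearMap.id_apply, Pi.zero_apply]
    linarith
  have h := hanti ht
  simp only [ContinuousLinearMap.id_apply, re_inner_self_eq_norm_sq, zero_smul,
    NormedSpace.exp_zero, one_apply_eq_self] at h
  exact abs_le_of_sq_le_sq' h (norm_nonneg _) |>.2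

/-- Two commuting dissipative operators generate flows that differ at time `t` by at most `t` times
the difference of the generators. -/
theorem norm_exp_sub_exp_le {M N : E →L[ℂ] E} (hM : ∀ x, (inner ℂ (M x) x).re ≤ 0)
    (hN : ∀ x, (inner ℂ (N x) x).re ≤ 0) (hc : Commute M N) (x : E) {t : ℝ} (ht : 0 ≤ t) :
    ‖NormedSpace.exp (t • M) x - NormedSpace.exp (t • N) x‖ ≤ ‖M x - N x‖ * t := by
  -- This curve runs from the flow of `N` at s = 0 to the flow of `M` at s = t. By commutativity its
  -- derivative is two contractions applied to `M x - N x`.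
  set g : ℝ → E := fun s => NormedSpace.exp ((t - s) • N) (NormedSpace.exp (s • M) x) with hg
  have hd : ∀ s, HasDerivAt g
      (NormedSpace.exp ((t - s) • N) (NormedSpace.exp (s • M) (M x - N x))) s := by
    intro s
    have h1 := ((hasDerivAt_exp_smul_const (𝕂 := ℝ) N (t - s)).scomp s
      ((hasDerivAt_id s).const_sub t))
    have h2 := hasDerivAt_exp_smul_const (𝕂 := ℝ) M s
    have h3 := h1.mul h2
    have h4 := ((ContinuousLinearMap.apply ℂ E x).restrictScalars ℝ).hasFDerivAt.comp_hasDerivAt s h3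
    refine h4.congr_deriv ?_
    have hcN : N * NormedSpace.exp (s • M) = NormedSpace.exp (s • M) * N :=
      ((hc.symm.smul_right s).exp_right).eq
    simp only [ContinuousLinearMap.coe_restrictScalars', ContinuousLinearMap.apply_apply,
      neg_smul, one_smul, neg_mul, mul_assoc, Function.comp_apply, hcN]
    simp [sub_eq_add_neg, add_comm]
  have key := norm_image_sub_le_of_norm_deriv_le_segment' (f := g) (a := 0) (b := t)
    (C := ‖M x - N x‖) (fun s _ => (hd s).hasDerivWithinAt) (fun s hs => by
      refine (norm_exp_apply_le hN _ (by linarith [hs.2])).trans (norm_exp_apply_le hM _ hs.1))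
    t (right_mem_Icc.2 ht)
  simpa [hg] using key

/-- The range of an injective dissipative operator is dense. -/
theorem denseRange_of_dissipative {G : E →L[ℂ] E} (hG : ∀ x, (inner ℂ (G x) x).re ≤ 0)
    (hinj : Function.Injective G) : DenseRange G := by
  have h : (LinearMap.range (G : E →ₗ[ℂ] E)).topologicalClosure = ⊤ := by
    rw [Submodule.topologicalClosure_eq_top_iff, Submodule.eq_bot_iff]
    intro x hx
    have h0 : ∀ y, inner ℂ (G y) x = 0 := fun y => hx (G y) ⟨y, rfl⟩
    -- For x orthogonal to the range, dissipativity at x + s G x loses its constant term and is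
    -- linear in s to leading order. A small positive s then forces G x = 0.
    have h1 : ∀ s : ℝ, s * ‖G x‖ ^ 2 + s ^ 2 * (inner ℂ (G (G x)) (G x)).re ≤ 0 := by
      intro s
      have := hG (x + (s : ℂ) • G x)
      rw [map_add, map_smul, inner_add_left, inner_add_right, inner_add_right, h0, inner_smul_left,
        inner_smul_left, h0, inner_smul_right, inner_smul_right] at this
      have e := re_inner_self_eq_norm_sq (G x)
      simp only [Complex.conj_ofReal, Complex.add_re, Complex.re_ofReal_mul, Complex.zero_re,
        mul_zero, e] at this
      nlinarith [this]
    have h2 : ‖G x‖ ^ 2 ≤ 0 := by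
      set a := ‖G x‖ ^ 2
      set b := (inner ℂ (G (G x)) (G x)).re
      have ha : 0 ≤ a := sq_nonneg _
      by_contra! hpos
      have hs : 0 < a / (|b| + 1) := by positivity
      have := h1 (a / (|b| + 1))
      have h3 : a / (|b| + 1) * |b| < a := by
        rw [div_mul_eq_mul_div, div_lt_iff₀ (by positivity)]
        nlinarith
      nlinarith [neg_abs_le b, mul_pos hs (sub_pos.2 h3), mul_nonneg (sq_nonneg (a / (|b| + 1)))
        (by linarith [neg_abs_le b] : 0 ≤ b + |b|)]
    have h4 : G x = 0 := by
      have : ‖G x‖ = 0 := by nlinarith [norm_nonneg (G x), sq_nonneg ‖G x‖]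
      exact norm_eq_zero.1 this
    exact hinj (by rw [h4, map_zero])
  have := Submodule.dense_iff_topologicalClosure_eq_top.2 h
  exact this

/-- The Yosida approximation `(G - ε)⁻¹` of the inverse of a dissipative operator. -/
theorem exists_yosida {G : E →L[ℂ] E} (hG : ∀ x, (inner ℂ (G x) x).re ≤ 0) {ε : ℝ} (hε : 0 < ε) :
    ∃ M : E →L[ℂ] E, (∀ x, M (G x - (ε : ℂ) • x) = x) ∧ (∀ x, G (M x) - (ε : ℂ) • M x = x) ∧
      (∀ x, (inner ℂ (M x) x).re ≤ 0) ∧ (∀ x, ‖(ε : ℂ) • M x‖ ≤ ‖x‖) := by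
  -- Subtracting ε makes the form coercive, so Lax–Milgram inverts `T`. The bounds on the inverse
  -- come from substituting x = T w.
  set T : E →L[ℂ] E := G - (ε : ℂ) • 1 with hT
  have hTx : ∀ x, T x = G x - (ε : ℂ) • x := fun x => by simp [hT]
  have hre : ∀ x, (inner ℂ (T x) x).re ≤ -(‖x‖ ^ 2 * ε) := by
    intro x
    have h := hG x
    have e := re_inner_self_eq_norm_sq x
    rw [hTx, inner_sub_left, inner_smul_left, Complex.conj_ofReal, Complex.sub_re,
      Complex.re_ofReal_mul, e]
    linarith
  have hlow : ∀ x, ‖x‖ ^ 2 * ε ≤ ‖inner ℂ (T x) x‖ := by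
    intro x
    have h1 := Complex.abs_re_le_norm (inner ℂ (T x) x)
    have h2 := neg_abs_le (inner ℂ (T x) x).re
    linarith [hre x]
  obtain ⟨U, hU⟩ := T.isUnit_of_forall_le_norm_inner_map (c := ⟨ε, hε.le⟩) hε hlow
  have hl : ∀ x, (↑U⁻¹ : E →L[ℂ] E) (T x) = x := fun x => by
    rw [← hU]; exact DFunLike.congr_fun U.inv_mul x
  have hr : ∀ x, T ((↑U⁻¹ : E →L[ℂ] E) x) = x := fun x => by
    rw [← hU]; exact DFunLike.congr_fun U.mul_inv x
  refine ⟨(↑U⁻¹ : E →L[ℂ] E), fun x => by rw [← hTx, hl], fun x => by rw [← hTx, hr],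
    fun x => ?_, fun x => ?_⟩
  · have h1 := hre ((↑U⁻¹ : E →L[ℂ] E) x)
    rw [hr] at h1
    have h2 := inner_re_symm (𝕜 := ℂ) x ((↑U⁻¹ : E →L[ℂ] E) x)
    simp only [RCLike.re_to_complex] at h2
    rw [← h2]
    exact h1.trans (neg_nonpos.2 (by positivity))
  · set w := (↑U⁻¹ : E →L[ℂ] E) x
    have h1 := hlow w
    rw [hr] at h1
    have h2 := norm_inner_le_norm (𝕜 := ℂ) x w
    rw [norm_smul, Complex.norm_real, Real.norm_of_nonneg hε.le]
    rcases (norm_nonneg w).eq_or_lt with h0 | h0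
    · rw [← h0, mul_zero]; exact norm_nonneg _
    · refine le_of_mul_le_mul_right ?_ h0
      nlinarith

/-- If `G` is injective and dissipative, then `z' = G⁻¹ z` has a mild solution for every initial
value. -/
theorem exists_mild_of_dissipative {G : E →L[ℂ] E} (hG : ∀ x, (inner ℂ (G x) x).re ≤ 0)
    (hinj : Function.Injective G) (x : E) :
    ∃ z : ℝ → E, ContinuousOn z (Ici 0) ∧ z 0 = x ∧
      ∀ t : ℝ, 0 ≤ t → G (z t - x) = ∫ s in (0 : ℝ)..t, z s := by
  set ε : ℕ → ℝ := fun n => 1 / ((n : ℝ) + 1) with hεdef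
  have hε : ∀ n, 0 < ε n := fun n => by positivity
  have hε0 : Filter.Tendsto ε Filter.atTop (𝓝 0) := tendsto_one_div_add_atTop_nhds_zero_nat
  choose M hMl hMr hMd hMn using fun n => exists_yosida hG (hε n)
  have hMG : ∀ n y, M n (G y) = y + (ε n : ℂ) • M n y := fun n y => by
    have := hMl n y
    rw [map_sub, map_smul] at this
    exact sub_eq_iff_eq_add.1 this
  have hGM : ∀ n y, G (M n y) = y + (ε n : ℂ) • M n y := fun n y => by
    rw [← sub_eq_iff_eq_add]; exact hMr n y
  have hcomm : ∀ n m, Commute (M n) (M m) := by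
    intro n m
    ext y
    have h1 := hMl n (M m (M n y))
    -- G commutes with each resolvent, so `G - ε n` sends `M m (M n y)` to `M m y`.
    have h2 : G (M m (M n y)) - (ε n : ℂ) • M m (M n y) = M m y := by
      rw [hGM, ← hMG, ← map_smul, ← map_sub, hMr]
    rw [h2] at h1
    exact h1
  -- The resolvent identity.
  have hres : ∀ n m y, M n y - M m y = ((ε n - ε m : ℝ) : ℂ) • M n (M m y) := by
    intro n m y
    have h1 := hMl n (M m y)
    rw [hGM] at h1
    have h2 : y + (ε m : ℂ) • M m y - (ε n : ℂ) • M m y = y - ((ε n - ε m : ℝ) : ℂ) • M m y := by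
      push_cast; rw [sub_smul]; abel
    rw [h2, map_sub, map_smul] at h1
    rw [sub_eq_iff_eq_add, add_comm, ← sub_eq_iff_eq_add]
    exact h1
  have hbd : ∀ n y, ‖M n (G y)‖ ≤ 2 * ‖y‖ := fun n y => by
    rw [hMG]
    exact (norm_add_le _ _).trans (by linarith [hMn n y])
  set f : ℕ → E → ℝ → E := fun n x t => NormedSpace.exp (t • M n) x with hf
  have hfsub : ∀ n x y t, f n x t - f n y t = f n (x - y) t := fun n x y t => by simp [hf]
  -- By the resolvent identity, the generators differ on G² y by (ε n - ε m) (M n G)(M m G) y, and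
  -- each factor M G has norm at most 2.
  have hflip : ∀ n m y t, 0 ≤ t →
      ‖f n (G (G y)) t - f m (G (G y)) t‖ ≤ |ε n - ε m| * (4 * ‖y‖) * t := by
    intro n m y t ht
    refine (norm_exp_sub_exp_le (hMd n) (hMd m) (hcomm n m) _ ht).trans ?_
    refine mul_le_mul_of_nonneg_right ?_ ht
    rw [hres, norm_smul, Complex.norm_real, Real.norm_eq_abs]
    refine mul_le_mul_of_nonneg_left ?_ (abs_nonneg _)
    have h1 : M m (G (G y)) = G (M m (G y)) := by rw [hMG, hGM]
    rw [h1]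
    linarith [hbd n (M m (G y)), hbd m y]
  have hdense : DenseRange fun y => G (G y) :=
    (denseRange_of_dissipative hG hinj).comp (denseRange_of_dissipative hG hinj) G.continuous
  have hcauchy : ∀ T : ℝ, UniformCauchySeqOn (fun n => f n x) Filter.atTop (Icc 0 T) := by
    intro T
    rw [Metric.uniformCauchySeqOn_iff]
    intro δ hδ
    obtain ⟨y, hy⟩ := hdense.exists_dist_lt x (by positivity : 0 < δ / 3)
    set B := 4 * ‖y‖ * |T| with hB
    have hB0 : 0 ≤ B := by positivity
    obtain ⟨N, hN⟩ := Metric.cauchySeq_iff.1 hε0.cauchySeq (δ / (3 * (B + 1))) (by positivity)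
    refine ⟨N, fun m hm n hn t ht => ?_⟩
    have h1 := hN m hm n hn
    rw [Real.dist_eq] at h1
    have h2 := hflip m n y t ht.1
    have h3 : |ε m - ε n| * (4 * ‖y‖) * t ≤ δ / (3 * (B + 1)) * B := by
      rw [mul_assoc]
      refine mul_le_mul h1.le ?_ (mul_nonneg (by positivity) ht.1) (by positivity)
      exact mul_le_mul_of_nonneg_left (ht.2.trans (le_abs_self T)) (by positivity)
    have h4 : δ / (3 * (B + 1)) * B < δ / 3 := by
      rw [div_mul_eq_mul_div, div_lt_div_iff₀ (by positivity) (by positivity)]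
      nlinarith
    have h5 : ∀ k, ‖f k x t - f k (G (G y)) t‖ < δ / 3 := fun k => by
      rw [hfsub]
      refine (norm_exp_apply_le (hMd k) _ ht.1).trans_lt ?_
      rwa [← dist_eq_norm]
    have h6 := h5 m
    have h7 := h5 n
    rw [norm_sub_rev] at h7
    rw [dist_eq_norm]
    have h8 : f m x t - f n x t = (f m x t - f m (G (G y)) t)
        + (f m (G (G y)) t - f n (G (G y)) t) + (f n (G (G y)) t - f n x t) := by abel
    rw [h8]
    refine (norm_add₃_le).trans_lt ?_
    linarith
  -- The limit is required only for t ≥ 0; 0 fills in the negative times.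
  have hlim : ∀ t, ∃ l, 0 ≤ t → Filter.Tendsto (fun n => f n x t) Filter.atTop (𝓝 l) := by
    intro t
    by_cases ht : 0 ≤ t
    · obtain ⟨l, hl⟩ := cauchySeq_tendsto_of_complete
        ((hcauchy t).cauchySeq (right_mem_Icc.2 ht))
      exact ⟨l, fun _ => hl⟩
    · exact ⟨0, fun h => absurd h ht⟩
  choose z hz using hlim
  have hfc : ∀ n, Continuous (f n x) := fun n =>
    continuous_iff_continuousAt.2 fun t => (hasDerivAt_exp_apply (M n) x t).continuousAt
  have hz0 : z 0 = x := by
    refine tendsto_nhds_unique (hz 0 le_rfl) ?_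
    simp [hf]
  refine ⟨z, fun t ht => ?_, hz0, fun t ht => ?_⟩
  · have h1 := (hcauchy (t + 1)).tendstoUniformlyOn_of_tendsto fun s hs => hz s hs.1
    have h2 := h1.continuousOn (Filter.Frequently.of_forall fun n => (hfc n).continuousOn)
    refine (h2 t ⟨ht, by linarith⟩).mono_of_mem_nhdsWithin ?_
    rw [← Ici_inter_Iic]
    exact inter_mem_nhdsWithin _ (Iic_mem_nhds (by linarith))
  -- The integrated equation of the n-th approximation with `M n` inverted; letting ε n → 0 gives
  -- the mild equation.
  · have h1 : ∀ n, G (f n x t - x) - (ε n : ℂ) • (f n x t - x) = ∫ s in (0 : ℝ)..t, f n x s := by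
      intro n
      have h2 : ∫ s in (0 : ℝ)..t, M n (f n x s) = f n x t - x := by
        rw [intervalIntegral.integral_eq_sub_of_hasDerivAt
          (fun s _ => hasDerivAt_exp_apply (M n) x s)
          (((M n).continuous.comp (hfc n)).intervalIntegrable _ _)]
        simp [hf]
      rw [ContinuousLinearMap.intervalIntegral_comp_comm _ ((hfc n).intervalIntegrable _ _)] at h2
      rw [← h2, hMr]
    have h3 : Filter.Tendsto (fun n => ∫ s in (0 : ℝ)..t, f n x s) Filter.atTop
        (𝓝 (∫ s in (0 : ℝ)..t, z s)) := by
      refine intervalIntegral.tendsto_integral_filter_of_dominated_convergence (fun _ => ‖x‖)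
        (Filter.Eventually.of_forall fun n => (hfc n).aestronglyMeasurable)
        (Filter.Eventually.of_forall fun n => Filter.Eventually.of_forall fun s hs => ?_)
        intervalIntegrable_const (Filter.Eventually.of_forall fun s hs => ?_)
      · rw [uIoc_of_le ht] at hs
        exact norm_exp_apply_le (hMd n) x hs.1.le
      · rw [uIoc_of_le ht] at hs
        exact hz s hs.1.le
    have h4 : Filter.Tendsto (fun n => G (f n x t - x) - (ε n : ℂ) • (f n x t - x)) Filter.atTop
        (𝓝 (G (z t - x) - ((0 : ℝ) : ℂ) • (z t - x))) := by
      have h5 := (hz t ht).sub_const x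
      exact ((G.continuous.tendsto _).comp h5).sub
        (((Complex.continuous_ofReal.tendsto 0).comp hε0).smul h5)
    simp only [h1, Complex.ofReal_zero, zero_smul, sub_zero] at h4
    exact tendsto_nhds_unique h4 h3

/-! ### Decay of mild solutions from a Lyapunov functional. -/

/-- Exponential decay of the mild solutions of `z' = G⁻¹ z`, given a quadratic Lyapunov functional
`x ↦ Re ⟨P x, x⟩`. -/
theorem norm_sq_le_of_lyapunov {G P : E →L[ℂ] E} {κ m K : ℝ} (hm : 0 < m)
    (hlow : ∀ x, m * ‖x‖ ^ 2 ≤ (inner ℂ (P x) x).re)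
    (hup : ∀ x, (inner ℂ (P x) x).re ≤ K * ‖x‖ ^ 2)
    (hP : ∀ w, (inner ℂ (P (G w)) w).re + (inner ℂ (P w) (G w)).re
      ≤ -κ * (inner ℂ (P (G w)) (G w)).re)
    {y : ℝ → E} (hy : ContinuousOn y (Ici 0))
    (hmild : ∀ t : ℝ, 0 ≤ t → G (y t - y 0) = ∫ s in (0 : ℝ)..t, y s) {t : ℝ} (ht : 0 ≤ t) :
    ‖y t‖ ^ 2 ≤ K / m * Real.exp (-κ * t) * ‖y 0‖ ^ 2 := by
  -- Extending y by the constant y 0 to negative times makes its primitive differentiable on all of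
  -- ℝ, in particular at 0.
  set Y : ℝ → E := fun s => y (max s 0) with hYdef
  have hYeq : ∀ s, 0 ≤ s → Y s = y s := fun s hs => by simp [hYdef, hs]
  have hY : Continuous Y := hy.comp_continuous (by fun_prop) fun s => le_max_right s 0
  have hYi : ∀ a b, IntervalIntegrable Y volume a b := fun a b => hY.intervalIntegrable a b
  have hYmild : ∀ s, 0 ≤ s → G (Y s - Y 0) = ∫ r in (0 : ℝ)..s, Y r := by
    intro s hs
    rw [hYeq s hs, hYeq 0 le_rfl, hmild s hs]
    refine intervalIntegral.integral_congr fun r hr => ?_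
    rw [uIcc_of_le hs] at hr
    exact (hYeq r hr.1).symm
  have hprim : ∀ s, HasDerivAt (fun s => ∫ r in (0 : ℝ)..s, Y r) (Y s) s := fun s =>
    intervalIntegral.integral_hasDerivAt_right (hYi _ _)
      hY.stronglyMeasurable.stronglyMeasurableAtFilter hY.continuousAt
  -- The integral over [s, s + h] is differentiable in s and satisfies G W' = W: it is a classical
  -- solution, to which the Lyapunov inequality applies with w = W'.
  set W : ℝ → ℝ → E := fun h s => (∫ r in (0 : ℝ)..(s + h), Y r) - ∫ r in (0 : ℝ)..s, Y r
    with hWdef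
  have hWd : ∀ h s, HasDerivAt (W h) (Y (s + h) - Y s) s := fun h s =>
    ((hprim (s + h)).comp_add_const s h).sub (hprim s)
  have hWG : ∀ h s, 0 ≤ h → 0 ≤ s → G (Y (s + h) - Y s) = W h s := by
    intro h s hh hs
    simp only [hWdef]
    rw [← hYmild _ hs, ← hYmild _ (add_nonneg hs hh), ← map_sub]
    congr 1; abel
  have hdecay : ∀ h, 0 ≤ h → ‖W h t‖ ^ 2 ≤ K / m * Real.exp (-κ * t) * ‖W h 0‖ ^ 2 := by
    intro h hh
    set F : ℝ → ℝ := fun s => Real.exp (κ * s) * (inner ℂ (P (W h s)) (W h s)).re with hF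
    have hFd : ∀ s, HasDerivAt F _ s := fun s =>
      (((hasDerivAt_id s).const_mul κ).exp).mul (hasDerivAt_re_inner_clm P (hWd h s))
    have hanti : AntitoneOn F (Ici 0) := by
      refine antitoneOn_of_hasDerivWithinAt_nonpos (convex_Ici 0)
        (fun s _ => (hFd s).continuousAt.continuousWithinAt)
        (fun s _ => (hFd s).hasDerivWithinAt) fun s hs => ?_
      rw [interior_Ici] at hs
      have h1 := hP (Y (s + h) - Y s)
      rw [hWG h s hh (le_of_lt hs)] at h1
      have h2 := Real.exp_pos (κ * s)
      simp only [id, mul_one]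
      nlinarith
    have h1 := hanti self_mem_Ici ht ht
    simp only [hF, mul_zero, Real.exp_zero, one_mul] at h1
    have h2 := h1.trans (hup _)
    have h3 := mul_le_mul_of_nonneg_left (hlow (W h t)) (Real.exp_pos (κ * t)).le
    have h4 := h3.trans h2
    rw [neg_mul, Real.exp_neg]
    have h5 := Real.exp_pos (κ * t)
    have h6 : K / m * (Real.exp (κ * t))⁻¹ * ‖W h 0‖ ^ 2
        = K * ‖W h 0‖ ^ 2 / (Real.exp (κ * t) * m) := by field_simp
    rw [h6, le_div_iff₀ (by positivity)]
    linarith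
  -- Window averages tend to Y as h → 0⁺, which carries the estimate from W back to y.
  have hlim : ∀ s, Filter.Tendsto (fun h : ℝ => ‖h⁻¹ • W h s‖ ^ 2) (𝓝[>] 0) (𝓝 (‖Y s‖ ^ 2)) := by
    intro s
    have h1 := (hasDerivAt_iff_tendsto_slope_zero.1 (hprim s)).mono_left
      (nhdsWithin_mono _ fun h (hh : 0 < h) => hh.ne')
    exact h1.norm.pow 2
  rw [← hYeq t ht, ← hYeq 0 le_rfl]
  refine le_of_tendsto_of_tendsto (hlim t) ((hlim 0).const_mul _) ?_
  filter_upwards [self_mem_nhdsWithin] with h hh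
  have h1 := hdecay h (le_of_lt hh)
  rw [norm_smul, norm_smul, mul_pow, mul_pow]
  have h2 := mul_le_mul_of_nonneg_left h1 (sq_nonneg ‖h⁻¹‖)
  linarith

end Abstract

noncomputable section

/-! ### The Dirichlet Laplacian on (0,1) and its inverse. -/

/-- The second derivative maps `V` onto `L²(0,1)`. -/
theorem V.D2_surjective : Function.Surjective V.D2 := by
  intro f
  have hcl : IsClosed (H10Graph : Set (L2 × L2)) := testGraph.isClosed_topologicalClosure
  have : CompleteSpace H10Graph := hcl.completeSpace_coe
  set g : H10Graph →L[ℂ] L2 := (ContinuousLinearMap.snd ℂ L2 L2).comp H10Graph.subtypeL with hg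
  -- Poincaré's inequality bounds the sup norm of the pair (u, u') by ‖u'‖, so the derivatives of
  -- H¹₀ functions form a closed subspace.
  have hanti : AntilipschitzWith 1 g := by
    refine g.antilipschitz_of_bound fun p => ?_
    have h := norm_le_of_mem_H10Graph p.2
    rw [NNReal.coe_one, one_mul]
    exact max_le h le_rfl
  have hrange : IsClosed (Set.range g) := hanti.isClosed_range g.uniformContinuous
  set e := g.equivRange hanti.injective hrange
  have : CompleteSpace g.range := hrange.completeSpace_coe
  set T : g.range →L[ℂ] L2 := ((ContinuousLinearMap.fst ℂ L2 L2).comp H10Graph.subtypeL).comp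
    (e.symm : g.range →L[ℂ] H10Graph) with hT
  have hTe : ∀ w : H10Graph, T (e w) = w.1.1 := fun w => by simp [hT]
  -- With T : u' ↦ u, the vector q = -T* f satisfies ⟨w', q⟩ = -⟨w, f⟩ for w in H¹₀, so f is its
  -- weak derivative. As q lies in the range of `g`, it is itself the derivative of some u in H¹₀,
  -- and u'' = f.
  set q : g.range := -(ContinuousLinearMap.adjoint T f) with hq
  have hqw : ∀ w : H10Graph, inner ℂ w.1.2 (q : L2) = -inner ℂ w.1.1 f := by
    intro w
    have h1 : inner ℂ (e w) q = -inner ℂ (T (e w)) f := by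
      rw [hq, inner_neg_right, ContinuousLinearMap.adjoint_inner_right]
    rw [hTe] at h1
    exact h1
  have hweak : HasWeakDeriv (q : L2) f := by
    rw [hasWeakDeriv_iff]
    intro φ w w' hφ hw hw'
    exact hqw ⟨(w, w'), testGraph.le_topologicalClosure ⟨φ, hφ, hw, hw'⟩⟩
  obtain ⟨⟨p, hp⟩, hpq⟩ := q.2
  have hmem : (p.1, (q : L2)) ∈ H10Graph := by
    have : p.2 = (q : L2) := hpq
    rwa [← this]
  obtain ⟨u, hu⟩ := V.exists_of_derivs hmem hweak
  exact ⟨u, V.D2_eq (by rw [hu]; exact hmem) hweak⟩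

/-- The second derivative as an isometry of `V` onto `L²(0,1)`. -/
def V.D2Equiv : V ≃ₗᵢ[ℂ] L2 where
  toLinearEquiv := LinearEquiv.ofBijective V.D2 ⟨V.D2_injective, V.D2_surjective⟩
  norm_map' _ := rfl

theorem V.D2Equiv_apply (u : V) : V.D2Equiv u = V.D2 u := rfl

theorem V.D2_symm (f : L2) : V.D2 (V.D2Equiv.symm f) = f := V.D2Equiv.apply_symm_apply f

theorem V.norm_incl_le (u : V) : ‖V.incl u‖ ≤ ‖u‖ := by
  obtain ⟨p, h1, h2⟩ := V.exists_deriv u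
  exact (norm_le_of_derivs h1 h2).1

/-- The inclusion `V → L²(0,1)` as a continuous map. -/
def V.inclL : V →L[ℂ] L2 := V.incl.mkContinuous 1 fun u => by
  rw [one_mul]; exact V.norm_incl_le u

/-- Both sides equal -⟨u', w'⟩: each of u and w lies in H¹₀, so no boundary term appears. -/
theorem V.inner_incl_D2 (u w : V) :
    inner ℂ (V.incl u) (V.D2 w) = inner ℂ (V.D2 u) (V.incl w) := by
  obtain ⟨p, h1, h2⟩ := V.exists_deriv u
  obtain ⟨r, h3, h4⟩ := V.exists_deriv w
  have e1 := h4.inner_H10Graph h1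
  have e2 := h2.inner_H10Graph h3
  simp only at e1 e2
  rw [← inner_conj_symm (V.D2 u), ← neg_eq_iff_eq_neg.2 e2, map_neg, inner_conj_symm,
    ← neg_eq_iff_eq_neg.2 e1]

/-- The solution operator `f ↦ u` of the Dirichlet problem `u'' = f`, `u(0) = u(1) = 0`. -/
def dirichletInv : L2 →L[ℂ] L2 := V.inclL.comp (V.D2Equiv.symm : L2 →L[ℂ] V)

theorem dirichletInv_apply (f : L2) : dirichletInv f = V.incl (V.D2Equiv.symm f) := rfl

theorem dirichletInv_D2 (u : V) : dirichletInv (V.D2 u) = V.incl u := by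
  rw [dirichletInv_apply, ← V.D2Equiv_apply, LinearIsometryEquiv.symm_apply_apply]

theorem norm_dirichletInv_le (f : L2) : ‖dirichletInv f‖ ≤ ‖f‖ := by
  rw [dirichletInv_apply]
  exact (V.norm_incl_le _).trans (by rw [LinearIsometryEquiv.norm_map])

theorem inner_dirichletInv (f g : L2) :
    inner ℂ (dirichletInv f) g = inner ℂ f (dirichletInv g) := by
  have := V.inner_incl_D2 (V.D2Equiv.symm f) (V.D2Equiv.symm g)
  rwa [V.D2_symm, V.D2_symm] at this

/-! ### The inverse of the generator -/

/-- The element of the energy space with given components. -/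
def mkH : V × L2 × L2 →L[ℂ] H :=
  ((WithLp.prodContinuousLinearEquiv 2 ℂ V (WithLp 2 (L2 × L2))).symm :
    V × WithLp 2 (L2 × L2) →L[ℂ] H).comp
  ((ContinuousLinearMap.fst ℂ V (L2 × L2)).prod
    (((WithLp.prodContinuousLinearEquiv 2 ℂ L2 L2).symm : L2 × L2 →L[ℂ] WithLp 2 (L2 × L2)).comp
      (ContinuousLinearMap.snd ℂ V (L2 × L2))))

/-- The displacement as a continuous linear map. -/
def uL : H →L[ℂ] V := WithLp.fstL 2 ℂ V (WithLp 2 (L2 × L2))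

/-- The velocity as a continuous linear map. -/
def vL : H →L[ℂ] L2 := (WithLp.fstL 2 ℂ L2 L2).comp (WithLp.sndL 2 ℂ V (WithLp 2 (L2 × L2)))

/-- The temperature as a continuous linear map. -/
def θL : H →L[ℂ] L2 := (WithLp.sndL 2 ℂ L2 L2).comp (WithLp.sndL 2 ℂ V (WithLp 2 (L2 × L2)))

theorem mkH_u (x : V × L2 × L2) : (mkH x).u = x.1 := rfl
theorem mkH_v (x : V × L2 × L2) : (mkH x).v = x.2.1 := rfl
theorem mkH_θ (x : V × L2 × L2) : (mkH x).θ = x.2.2 := rfl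

theorem H.ext {z w : H} (hu : z.u = w.u) (hv : z.v = w.v) (hθ : z.θ = w.θ) : z = w :=
  WithLp.ofLp_injective 2 (Prod.ext hu (WithLp.ofLp_injective 2 (Prod.ext hv hθ)))

theorem H.inner_eq (z w : H) :
    inner ℂ z w = inner ℂ (V.D2 z.u) (V.D2 w.u) + (inner ℂ z.v w.v + inner ℂ z.θ w.θ) := rfl

theorem H.norm_sq_eq (z : H) : ‖z‖ ^ 2 = ‖V.D2 z.u‖ ^ 2 + (‖z.v‖ ^ 2 + ‖z.θ‖ ^ 2) := by
  rw [WithLp.prod_norm_sq_eq_of_L2, WithLp.prod_norm_sq_eq_of_L2]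
  rfl

theorem integral_norm_sq_eq (f : L2) : ∫ x in Ioo (0 : ℝ) 1, ‖f x‖ ^ 2 = ‖f‖ ^ 2 := by
  have h := L2.inner_def (𝕜 := ℂ) f f
  rw [inner_self_eq_norm_sq_to_K] at h
  simp only [inner_self_eq_norm_sq_to_K] at h
  have h2 : ∫ x in Ioo (0 : ℝ) 1, ((‖f x‖ : ℂ)) ^ 2
      = ((∫ x in Ioo (0 : ℝ) 1, ‖f x‖ ^ 2 : ℝ) : ℂ) := by
    rw [← integral_complex_ofReal]
    simp
  have h3 : ((‖f‖ ^ 2 : ℝ) : ℂ) = ((∫ x in Ioo (0 : ℝ) 1, ‖f x‖ ^ 2 : ℝ) : ℂ) := by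
    rw [← h2]; push_cast; exact h
  exact (Complex.ofReal_injective h3).symm

theorem energy_eq (z : H) : energy z = (1 / 2) * ‖z‖ ^ 2 := by
  simp only [energy, integral_norm_sq_eq, H.norm_sq_eq, add_assoc]

/-- The inverse of the generator `𝒜`. -/
def genInv (α β : ℝ) : H →L[ℂ] H :=
  -- In 𝒜 z = w the third equation gives θ, the second gives u'' = -Δ⁻¹ w.v - αθ, and the first
  -- gives v.
  let θ : H →L[ℂ] L2 := (β : ℂ)⁻¹ • ((α : ℂ) • (V.D2Equiv : V →L[ℂ] L2).comp uL - θL)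
  mkH.comp (((V.D2Equiv.symm : L2 →L[ℂ] V).comp (-(dirichletInv.comp vL) - (α : ℂ) • θ)).prod
    ((V.inclL.comp uL).prod θ))

section

variable {α β : ℝ}

theorem genInv_θ (w : H) :
    (genInv α β w).θ = (β : ℂ)⁻¹ • ((α : ℂ) • V.D2 w.u - w.θ) := rfl

theorem genInv_v (w : H) : (genInv α β w).v = V.incl w.u := rfl

theorem D2_genInv_u (w : H) :
    V.D2 (genInv α β w).u = -dirichletInv w.v - (α : ℂ) • (genInv α β w).θ :=
  V.D2_symm _

/-- Because u ↦ u'' is onto `L2`, testing against every φ'' turns the variational equation into the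
pointwise identity u'' + αθ = -Δ⁻¹ w.v. The condition that the functional lie in L² is thereby built
in. -/
theorem isGenerator_iff (hβ : β ≠ 0) {z w : H} : IsGenerator α β z w ↔ genInv α β w = z := by
  have hβ' : (β : ℂ) ≠ 0 := Complex.ofReal_ne_zero.2 hβ
  have hform : (∀ φ : V, inner ℂ (V.D2 φ) (V.D2 z.u) + (α : ℂ) * inner ℂ (V.D2 φ) z.θ
      = -inner ℂ (V.incl φ) w.v) ↔ V.D2 z.u = -dirichletInv w.v - (α : ℂ) • z.θ := by
    have h1 : ∀ φ : V, (inner ℂ (V.D2 φ) (V.D2 z.u) + (α : ℂ) * inner ℂ (V.D2 φ) z.θ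
        = -inner ℂ (V.incl φ) w.v) ↔
        inner ℂ (V.D2 φ) (V.D2 z.u) = inner ℂ (V.D2 φ) (-dirichletInv w.v - (α : ℂ) • z.θ) := by
      intro φ
      rw [← dirichletInv_D2, inner_dirichletInv, inner_sub_right, inner_neg_right,
        inner_smul_right, ← eq_sub_iff_add_eq]
    simp only [h1]
    refine ⟨fun h => ext_inner_left ℂ fun f => ?_, fun h φ => by rw [h]⟩
    have := h (V.D2Equiv.symm f)
    rwa [V.D2_symm] at this
  constructor
  · rintro ⟨h1, h2, h3⟩
    have hθ : (genInv α β w).θ = z.θ := by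
      rw [genInv_θ, h3, sub_sub_cancel, inv_smul_smul₀ hβ']
    refine H.ext (V.D2_injective ?_) (by rw [genInv_v, h1]) hθ
    rw [D2_genInv_u, hform.1 h2, hθ]
  · rintro rfl
    refine ⟨(genInv_v w).symm, hform.2 (D2_genInv_u w), ?_⟩
    rw [genInv_θ, smul_inv_smul₀ hβ', sub_sub_cancel]

theorem genInv_injective (hβ : β ≠ 0) : Function.Injective (genInv α β) := by
  refine (injective_iff_map_eq_zero _).2 fun w hw => ?_
  obtain ⟨h1, h2, h3⟩ := (isGenerator_iff hβ).2 hw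
  have hu : w.u = 0 := V.incl_injective (by rw [h1, map_zero]; rfl)
  have hv : w.v = 0 := by
    have h4 := D2_genInv_u (α := α) (β := β) w
    rw [hw] at h4
    have h5 : dirichletInv w.v = 0 := by
      have : -dirichletInv w.v = 0 := by
        simpa [H.u, H.θ] using h4.symm
      simpa using this
    rw [dirichletInv_apply, ← map_zero V.incl] at h5
    simpa using V.incl_injective h5
  refine H.ext hu hv ?_
  rw [h3, hu]
  simp [H.θ]

/-- The dissipation identity: the energy is lost through the temperature only. -/
theorem re_inner_genInv (hβ : β ≠ 0) (w : H) :
    (inner ℂ (genInv α β w) w).re = -β * ‖(genInv α β w).θ‖ ^ 2 := by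
  obtain ⟨h1, h2, h3⟩ := (isGenerator_iff (α := α) hβ (w := w)).2 rfl
  set z := genInv α β w
  have hu : V.D2 z.u = -dirichletInv w.v - (α : ℂ) • z.θ := D2_genInv_u w
  rw [H.inner_eq, hu, ← h1, h3, ← dirichletInv_D2, inner_dirichletInv (V.D2 w.u), inner_sub_left,
    inner_neg_left, inner_smul_left, inner_sub_right, inner_smul_right, inner_smul_right,
    Complex.conj_ofReal, inner_dirichletInv]
  have e := re_inner_self_eq_norm_sq z.θ
  have s2 := inner_re_symm (𝕜 := ℂ) (V.D2 w.u) (dirichletInv w.v)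
  simp only [RCLike.re_to_complex] at s2
  simp only [Complex.add_re, Complex.sub_re, Complex.neg_re, Complex.re_ofReal_mul, e]
  rw [inner_dirichletInv] at s2
  linarith

end

/-! ### The Lyapunov functional -/

/-- The operator of the quadratic form `N ‖z‖² + Re ⟨u - c Δ⁻¹ θ, v⟩`. -/
def lyapunov (N c : ℝ) : H →L[ℂ] H :=
  (N : ℂ) • .id ℂ H +
    mkH.comp ((0 : H →L[ℂ] V).prod
      ((V.inclL.comp uL - (c : ℂ) • dirichletInv.comp θL).prod (0 : H →L[ℂ] L2)))

theorem inner_lyapunov (N c : ℝ) (z w : H) :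
    inner ℂ (lyapunov N c z) w =
      N * inner ℂ z w + inner ℂ (V.incl z.u - (c : ℂ) • dirichletInv z.θ) w.v := by
  have h : lyapunov N c z = (N : ℂ) • z +
      mkH (0, V.incl z.u - (c : ℂ) • dirichletInv z.θ, 0) := rfl
  rw [h, inner_add_left, inner_smul_left, Complex.conj_ofReal, H.inner_eq (mkH _), mkH_u, mkH_v,
    mkH_θ]
  simp

/-- This makes the functional comparable to ‖z‖² as soon as N exceeds 1 + c. -/
theorem abs_re_lyapunov_cross_le {c : ℝ} (hc : 0 ≤ c) (z : H) :
    |(inner ℂ (V.incl z.u - (c : ℂ) • dirichletInv z.θ) z.v).re| ≤ (1 + c) * ‖z‖ ^ 2 := by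
  have h1 : ‖V.incl z.u - (c : ℂ) • dirichletInv z.θ‖ ≤ ‖V.D2 z.u‖ + c * ‖z.θ‖ := by
    refine (norm_sub_le _ _).trans (add_le_add (V.norm_incl_le _) ?_)
    rw [norm_smul, Complex.norm_real, Real.norm_of_nonneg hc]
    exact mul_le_mul_of_nonneg_left (norm_dirichletInv_le _) hc
  have h2 := (Complex.abs_re_le_norm _).trans
    (norm_inner_le_norm (𝕜 := ℂ) (V.incl z.u - (c : ℂ) • dirichletInv z.θ) z.v)
  refine h2.trans ((mul_le_mul_of_nonneg_right h1 (norm_nonneg _)).trans ?_)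
  rw [H.norm_sq_eq]
  nlinarith [sq_nonneg (‖V.D2 z.u‖ - ‖z.v‖), sq_nonneg (‖z.θ‖ - ‖z.v‖), sq_nonneg ‖V.D2 z.u‖,
    sq_nonneg ‖z.θ‖, sq_nonneg ‖z.v‖, mul_nonneg hc (sq_nonneg (‖z.θ‖ - ‖z.v‖)),
    mul_nonneg hc (sq_nonneg ‖V.D2 z.u‖), mul_nonneg hc (sq_nonneg ‖z.θ‖),
    mul_nonneg hc (sq_nonneg ‖z.v‖)]

theorem abs_re_inner_le {F : Type*} [NormedAddCommGroup F] [InnerProductSpace ℂ F] (x y : F) :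
    |(inner ℂ x y).re| ≤ ‖x‖ * ‖y‖ :=
  (Complex.abs_re_le_norm _).trans (norm_inner_le_norm x y)

/-- The derivative of the Lyapunov functional along the flow. -/
theorem re_inner_lyapunov_deriv {α β : ℝ} (hα : α ≠ 0) (hβ : β ≠ 0) (N : ℝ) (w : H) :
    (inner ℂ (lyapunov N (2 / α) (genInv α β w)) w).re
      + (inner ℂ (lyapunov N (2 / α) w) (genInv α β w)).re
      = -‖V.D2 (genInv α β w).u‖ ^ 2 - ‖(genInv α β w).v‖ ^ 2
        + (2 / α - α) * (inner ℂ (V.D2 (genInv α β w).u) (genInv α β w).θ).re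
        + 2 / α * β * (inner ℂ (dirichletInv (genInv α β w).θ) (genInv α β w).v).re
        + (2 - 2 * N * β) * ‖(genInv α β w).θ‖ ^ 2 := by
  have hdis := re_inner_genInv (α := α) hβ w
  obtain ⟨h1, -, h3⟩ := (isGenerator_iff (α := α) hβ (w := w)).2 rfl
  have hu := D2_genInv_u (α := α) (β := β) w
  set z := genInv α β w
  -- The components of w = 𝒜 z enter the cross terms only through Δ⁻¹, so they can be rewritten in
  -- bounded quantities of z.
  have hBv : dirichletInv w.v = -V.D2 z.u - (α : ℂ) • z.θ := by rw [hu]; abel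
  have hBθ : dirichletInv w.θ = (α : ℂ) • z.v - (β : ℂ) • dirichletInv z.θ := by
    rw [h3, map_sub, map_smul, map_smul, dirichletInv_D2, h1]
  have s1 := inner_re_symm (𝕜 := ℂ) z w
  have s2 := inner_re_symm (𝕜 := ℂ) z.θ (V.D2 z.u)
  simp only [RCLike.re_to_complex] at s1 s2
  have e1 := re_inner_self_eq_norm_sq z.θ
  have e2 := re_inner_self_eq_norm_sq z.v
  have e3 := re_inner_self_eq_norm_sq (V.D2 z.u)
  rw [inner_lyapunov, inner_lyapunov, h1, hBθ, inner_sub_left, ← dirichletInv_D2 z.u,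
    inner_dirichletInv, inner_smul_left, inner_dirichletInv z.θ w.v, hBv]
  simp only [inner_sub_left, inner_sub_right, inner_neg_right, inner_smul_left, inner_smul_right,
    Complex.conj_ofReal, Complex.add_re, Complex.sub_re, Complex.neg_re, Complex.re_ofReal_mul,
    e1, e2, e3, s2, ← s1, hdis]
  field_simp
  ring

/-- The mild solutions decay exponentially, uniformly in the initial value. -/
theorem exists_decay {α β : ℝ} (hα : 0 < α) (hβ : 0 < β) :
    ∃ C κ : ℝ, 0 < C ∧ 0 < κ ∧ ∀ y : ℝ → H, ContinuousOn y (Ici 0) →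
      (∀ t : ℝ, 0 ≤ t → genInv α β (y t - y 0) = ∫ s in (0 : ℝ)..t, y s) →
      ∀ t : ℝ, 0 ≤ t → ‖y t‖ ^ 2 ≤ C * Real.exp (-κ * t) * ‖y 0‖ ^ 2 := by
  set c := 2 / α with hcdef
  have hc : 0 < c := by positivity
  -- The θ terms to absorb: two from Young's inequality, 2 from the derivative of the cross terms,
  -- and 1/2 from the decay rate times the functional. In N, the part 2 + c gives the lower bound 1
  -- for the functional, and S / (2β) gives 2Nβ ≥ S.
  set S := (c - α) ^ 2 / 2 + (c * β) ^ 2 / 2 + 5 / 2 with hS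
  have hS0 : 0 ≤ S := by positivity
  set N := 2 + c + S / (2 * β) with hN
  have hNβ : S ≤ 2 * N * β := by
    have : 2 * (S / (2 * β)) * β = S := by field_simp
    rw [hN]
    nlinarith [mul_pos hc hβ]
  have hNc : 1 ≤ N - (1 + c) := by
    have : 0 ≤ S / (2 * β) := by positivity
    rw [hN]; linarith
  set K := N + (1 + c) with hK
  have hK0 : 0 < K := by linarith
  have hre : ∀ z : H, (inner ℂ (lyapunov N c z) z).re = N * ‖z‖ ^ 2
      + (inner ℂ (V.incl z.u - (c : ℂ) • dirichletInv z.θ) z.v).re := fun z => by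
    rw [inner_lyapunov, Complex.add_re, Complex.re_ofReal_mul, re_inner_self_eq_norm_sq]
  have hup : ∀ z : H, (inner ℂ (lyapunov N c z) z).re ≤ K * ‖z‖ ^ 2 := fun z => by
    have := (abs_le.1 (abs_re_lyapunov_cross_le hc.le z)).2
    rw [hre, hK]; linarith
  -- The rate 1 / (2K) costs at most ‖z‖² / 2, which is what Young's inequality leaves of -‖u''‖² -
  -- ‖v‖².
  refine ⟨K / 1, 1 / (2 * K), by positivity, by positivity, fun y hy hmild t ht =>
    norm_sq_le_of_lyapunov (P := lyapunov N c) one_pos (fun z => ?_) hup (fun w => ?_) hy hmild ht⟩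
  · have := (abs_le.1 (abs_re_lyapunov_cross_le hc.le z)).1
    rw [hre]
    nlinarith [sq_nonneg ‖z‖]
  · rw [re_inner_lyapunov_deriv hα.ne' hβ.ne']
    set z := genInv α β w
    have h1 : 1 / (2 * K) * (inner ℂ (lyapunov N c z) z).re ≤ 1 / 2 * ‖z‖ ^ 2 := by
      refine (mul_le_mul_of_nonneg_left (hup z) (by positivity)).trans_eq ?_
      field_simp
    rw [H.norm_sq_eq] at h1
    have h2 : (c - α) * (inner ℂ (V.D2 z.u) z.θ).re
        ≤ 1 / 2 * ‖V.D2 z.u‖ ^ 2 + (c - α) ^ 2 / 2 * ‖z.θ‖ ^ 2 := by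
      have h3 := abs_re_inner_le (V.D2 z.u) z.θ
      have h4 := le_abs_self ((c - α) * (inner ℂ (V.D2 z.u) z.θ).re)
      rw [abs_mul] at h4
      have h5 := mul_le_mul_of_nonneg_left h3 (abs_nonneg (c - α))
      rw [← sq_abs (c - α)]
      nlinarith [sq_nonneg (‖V.D2 z.u‖ - |c - α| * ‖z.θ‖)]
    have h3 : c * β * (inner ℂ (dirichletInv z.θ) z.v).re
        ≤ 1 / 2 * ‖z.v‖ ^ 2 + (c * β) ^ 2 / 2 * ‖z.θ‖ ^ 2 := by
      have h4 := (le_abs_self _).trans (abs_re_inner_le (dirichletInv z.θ) z.v)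
      have h5 := h4.trans (mul_le_mul_of_nonneg_right (norm_dirichletInv_le z.θ) (norm_nonneg _))
      have h6 := mul_le_mul_of_nonneg_left h5 (mul_pos hc hβ).le
      nlinarith [sq_nonneg (‖z.v‖ - c * β * ‖z.θ‖)]
    have h4 := mul_le_mul_of_nonneg_right hNβ (sq_nonneg ‖z.θ‖)
    rw [hS] at h4
    linarith

end

end HingedBeam

/-! ### Well-posedness and uniform decay for the beam. -/

theorem mainTheorem6 (α β : ℝ) (hα : 0 < α) (hβ : 0 < β) :
    (∀ z₀ : HingedBeam.H, ∃ z : ℝ → HingedBeam.H, HingedBeam.IsMildSolution α β z₀ z ∧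
      ∀ z' : ℝ → HingedBeam.H, HingedBeam.IsMildSolution α β z₀ z' →
        Set.EqOn z' z (Set.Ici 0)) ∧
    ∃ C κ : ℝ, 0 < C ∧ 0 < κ ∧
      ∀ (z₀ : HingedBeam.H) (z : ℝ → HingedBeam.H), HingedBeam.IsMildSolution α β z₀ z →
        ∀ t : ℝ, 0 ≤ t →
          HingedBeam.energy (z t) ≤ C * Real.exp (-κ * t) * HingedBeam.energy (z 0) := by
  obtain ⟨C, κ, hC, hκ, hdecay⟩ := HingedBeam.exists_decay hα hβ
  have hmild : ∀ {z₀ z}, HingedBeam.IsMildSolution α β z₀ z → ∀ t : ℝ, 0 ≤ t →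
      HingedBeam.genInv α β (z t - z 0) = ∫ s in (0 : ℝ)..t, z s := fun hz t ht => by
    rw [hz.initial]; exact (HingedBeam.isGenerator_iff hβ.ne').1 (hz.integrated t ht)
  refine ⟨fun z₀ => ?_, C, κ, hC, hκ, fun z₀ z hz t ht => ?_⟩
  · obtain ⟨z, hzc, hz0, hz⟩ := HingedBeam.exists_mild_of_dissipative
      (G := HingedBeam.genInv α β)
      (fun w => by
        rw [HingedBeam.re_inner_genInv hβ.ne', neg_mul]
        exact neg_nonpos.2 (by positivity))
      (HingedBeam.genInv_injective hβ.ne') z₀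
    have hsol : HingedBeam.IsMildSolution α β z₀ z :=
      ⟨hzc, hz0, fun t ht => (HingedBeam.isGenerator_iff hβ.ne').2 (hz t ht)⟩
    refine ⟨z, hsol, fun z' hz' t ht => ?_⟩
    have hint : ∀ {y : ℝ → HingedBeam.H}, ContinuousOn y (Set.Ici 0) → ∀ t : ℝ, 0 ≤ t →
        IntervalIntegrable y MeasureTheory.volume 0 t := fun hy t ht =>
      (hy.mono (by rw [Set.uIcc_of_le ht]; exact Set.Icc_subset_Ici_self)).intervalIntegrable
    -- The difference of two solutions satisfies the same integrated equation with initial value 0,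
    -- so the decay bound makes it vanish.
    have h := hdecay (fun s => z' s - z s) (hz'.continuousOn.sub hzc) (fun s hs => by
      rw [intervalIntegral.integral_sub (hint hz'.continuousOn s hs) (hint hzc s hs),
        ← hmild hz' s hs, ← hmild hsol s hs, ← map_sub]
      congr 1; abel) t ht
    rw [hz'.initial, hz0, sub_self, norm_zero, zero_pow two_ne_zero, mul_zero] at h
    have h0 : ‖z' t - z t‖ = 0 := pow_eq_zero_iff two_ne_zero |>.1 (le_antisymm h (sq_nonneg _))
    exact sub_eq_zero.1 (norm_eq_zero.1 h0)
  · rw [HingedBeam.energy_eq, HingedBeam.energy_eq]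
    linarith [hdecay z hz.continuousOn (hmild hz) t ht]
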